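/- Let $p_1,p_2\ge 0$ and $p=p_1+p_2$. Rounding map. For $j=1,\dots,p_1$ let $h_{1,j}:\mathbb R\to\mathbb R$ be monotone, one-to-one and differentiable, with derivative nonzero Lebesgue-almost everywhere. Put $h_1(x_1)=(h_{1,1}(x_{1,1}),\dots,h_{1,p_1}(x_{1,p_1}))$ and $\mathcal Y=h_1(\mathbb R^{p_1})$. For $j=1,\dots,p_2$ let $q_j\in\mathbb N\cup\{\infty\}$ and let $(A^{(j)}_k)_{0\le k<q_j}$ be a partition of $\mathbb R$ into nonempty sets such that every point of $A^{(j)}_k$ is smaller than every point of $A^{(j)}_l$ when $k<l$. Put $Q=\prod_{j}\{k\in\mathbb N: k<q_j\}$ and, for $y_2\in Q$, $A_{y_2}=\{x_2\in\mathbb R^{p_2}: x_{2,j}\in A^{(j)}_{y_{2,j}}\text{ for all }j\}$. Densities. Let $\mathcal F^*$ be the set of probability densities on $\mathbb R^p$ with respect to Lebesgue measure, and $\mathcal F$ the set of probability densities on $\mathcal Y\times Q$ with respect to $\mu$, the product of Lebesgue measure and counting measure. In both sets, densities that agree almost everywhere are identified. Both carry the $L_1$ distance $\|\cdot\|$ and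 its Borel $\sigma$-algebra. Define $g:\mathcal F^*\to\mathcal F$ by $$g(f^*)(y_1,y_2)=\int_{A_{y_2}} f^*\big(h_1^{-1}(y_1),x_2\big)\,\big|\det J_{h_1^{-1}}(y_1)\big|\,dx_2 ,$$ where $J_{h_1^{-1}}$ is the Jacobian matrix of $h_1^{-1}$ (it exists almost everywhere on $\mathcal Y$). Prior and posterior. Let $\Pi^*$ be a probability measure on $\mathcal F^*$ and let $\Pi=\Pi^*\circ g^{-1}$ be the induced prior on $\mathcal F$. For $f\in\mathcal F$ let $P_f$ be the probability measure with density $f$ with respect to $\mu$. Let $\Pi(\cdot\mid y_1,\dots,y_n)$ be the posterior, i.e. the conditional distribution of $f$ given $y_1,\dots,y_n$ when $f\sim\Pi$ and, given $f$, the observations $y_1,\dots,y_n$ are i.i.d. with law $P_f$. Theorem. Let $f_0\in\mathcal F$ be in the Kullback–Leibler support of $\Pi$, i.e. $\Pi\{f\in\mathcal F:\int f_0\log(f_0/f)\,d\mu<\eta\}>0$ for every $\eta>0$. For $\delta>0$ and $S\subseteq\mathcal F^*$ let $J(\delta,S)\in[-\infty,\infty]$ be the logarithm of the minimum number of open $L_1$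 balls of radius $\delta$ centred in $\mathcal F^*$ that are needed to cover $S$. Suppose that for each $\epsilon>0$ there are $0<\delta<\epsilon$, $c_1,c_2>0$, $\beta<\epsilon^2/8$ and sets $\mathcal F^*_n\subseteq\mathcal F^*$ such that for all sufficiently large $n$ (i) $\Pi^*\big((\mathcal F^*_n)^C\big)\le c_1e^{-nc_2}$ (outer measure if $\mathcal F_n^*$ is not measurable); (ii) $J(\delta,\mathcal F_n^*)<n\beta$. Then for every $\epsilon>0$, with $U=\{f\in\mathcal F:\|f-f_0\|<\epsilon\}$, $$\Pi(U\mid y_1,\dots,y_n)\to 1\quad (n\to\infty)\qquad\text{almost surely when } y_1,y_2,\dots \text{ are i.i.d. with law } P_{f_0}.$$ -/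

import Mathlib

open MeasureTheory ProbabilityTheory Filter Topology Set
open scoped ENNReal

namespace MixedScale

noncomputable section

section Densities

/-- The set of probability densities with respect to `μ`, as elements of the space `L¹(μ)` (so
densities that agree `μ`-almost everywhere are identified): non-negative, with integral one. -/
def Density {α : Type*} [MeasurableSpace α] (μ : Measure α) : Type _ :=
  {f : α →₁[μ] ℝ // 0 ≤ f ∧ ∫ x, f x ∂μ = 1}

variable {α : Type*} [MeasurableSpace α] {μ : Measure α}

/-- The metric on densities is the `L¹` distance `∫ |f - f'| dμ`. -/
instance : MetricSpace (Density μ) :=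
  inferInstanceAs (MetricSpace {f : α →₁[μ] ℝ // 0 ≤ f ∧ ∫ x, f x ∂μ = 1})

/-- Densities carry the Borel σ-algebra of the `L¹` distance. -/
instance : MeasurableSpace (Density μ) := borel _

instance : BorelSpace (Density μ) := ⟨rfl⟩

/-- A density as an element of `L¹(μ)`. -/
def Density.toL1 (f : Density μ) : α →₁[μ] ℝ := Subtype.val f

instance : CoeFun (Density μ) (fun _ => α → ℝ) := ⟨fun f => f.toL1⟩

theorem Density.stronglyMeasurable (f : Density μ) : StronglyMeasurable f :=
  Lp.stronglyMeasurable f.toL1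

theorem Density.continuous_toL1 : Continuous (Density.toL1 : Density μ → (α →₁[μ] ℝ)) :=
  continuous_subtype_val

/-- The distance of two densities is the integral of the absolute difference. -/
theorem Density.dist_eq (f f' : Density μ) : dist f f' = ∫ x, |f x - f' x| ∂μ := by
  have h : dist f f' = dist f.toL1 f'.toL1 := rfl
  rw [h, L1.dist_eq_integral_dist]
  rfl

theorem Density.nonneg (f : Density μ) : ∀ᵐ x ∂μ, 0 ≤ f x := by
  have := (Lp.coeFn_nonneg f.toL1).2 f.2.1
  filter_upwards [this] with x hx using hx

theorem Density.integrable (f : Density μ) : Integrable f μ := L1.integrable_coeFn f.toL1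

theorem Density.integral_eq (f : Density μ) : ∫ x, f x ∂μ = 1 := f.2.2

theorem Density.lintegral_eq (f : Density μ) : ∫⁻ x, ENNReal.ofReal (f x) ∂μ = 1 := by
  rw [← ofReal_integral_eq_lintegral_ofReal f.integrable f.nonneg, f.integral_eq, ENNReal.ofReal_one]

/-- An integrable function that is almost everywhere non-negative and has integral one, viewed as
a density. -/
def Density.mk (f : α → ℝ) (hf : Integrable f μ) (h0 : 0 ≤ᵐ[μ] f) (h1 : ∫ x, f x ∂μ = 1) :
    Density μ :=
  ⟨hf.toL1 f, (Lp.coeFn_nonneg _).1 (h0.trans_eq hf.coeFn_toL1.symm),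
    (integral_congr_ae hf.coeFn_toL1).trans h1⟩

theorem Density.coe_mk (f : α → ℝ) (hf : Integrable f μ) (h0 : 0 ≤ᵐ[μ] f)
    (h1 : ∫ x, f x ∂μ = 1) : (Density.mk f hf h0 h1 : α → ℝ) =ᵐ[μ] f :=
  hf.coeFn_toL1

/-- The probability measure `P_f` with density `f` with respect to `μ`. -/
def Density.law (f : Density μ) : Measure α := μ.withDensity fun x => ENNReal.ofReal (f x)

instance (f : Density μ) : IsProbabilityMeasure f.law :=
  ⟨by rw [Density.law, withDensity_apply _ MeasurableSet.univ, Measure.restrict_univ,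
    f.lintegral_eq]⟩

theorem Density.isClosed_aux :
    IsClosed {f : α →₁[μ] ℝ | 0 ≤ f ∧ ∫ x, f x ∂μ = 1} :=
  (isClosed_le (continuous_const (y := (0 : α →₁[μ] ℝ))) continuous_id).inter
    (isClosed_eq continuous_integral continuous_const)

instance [MeasurableSpace.CountablyGenerated α] [SFinite μ] : PolishSpace (Density μ) := by
  have : Fact ((1 : ℝ≥0∞) ≠ ∞) := ⟨ENNReal.one_ne_top⟩
  have : PolishSpace (α →₁[μ] ℝ) := inferInstance
  exact (Density.isClosed_aux (μ := μ)).polishSpace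

theorem Density.measurable_law : Measurable (Density.law : Density μ → Measure α) := by
  refine Measure.measurable_of_measurable_coe _ fun s hs => ?_
  have h : (fun f : Density μ => f.law s) = fun f => ENNReal.ofReal (∫ x in s, f x ∂μ) := by
    funext f
    rw [Density.law, withDensity_apply _ hs,
      ofReal_integral_eq_lintegral_ofReal f.integrable.integrableOn (ae_restrict_of_ae f.nonneg)]
  rw [h]
  have hc : Continuous fun f : Density μ => ∫ x in s, f x ∂μ :=
    (continuous_setIntegral s).comp Density.continuous_toL1
  exact (ENNReal.continuous_ofReal.comp hc).measurable

/-- The law of `n` independent observations from the density `f`, as a Markov kernel in `f`. -/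
def sample (μ : Measure α) (n : ℕ) : Kernel (Density μ) (Fin n → α) where
  toFun f := Measure.pi fun _ => f.law
  measurable' := by
    refine .measure_of_isPiSystem_of_isProbabilityMeasure generateFrom_pi.symm isPiSystem_pi ?_
    rintro _ ⟨s, hs, rfl⟩
    simp only [Measure.pi_pi]
    exact Finset.measurable_prod _ fun i _ =>
      (Measure.measurable_coe (hs i trivial)).comp Density.measurable_law

instance (n : ℕ) : IsMarkovKernel (sample μ n) :=
  ⟨fun f => inferInstanceAs (IsProbabilityMeasure (Measure.pi fun _ => f.law))⟩

/-- The posterior distribution of the density given `n` observations that are independent with law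
`P_f` given `f`, when `f` has prior law `π`: the conditional law of `f` given the observations. -/
def posteriorDist [MeasurableSpace.CountablyGenerated α] [SFinite μ] [Nonempty (Density μ)]
    (π : Measure (Density μ)) [IsFiniteMeasure π] (n : ℕ) : Kernel (Fin n → α) (Density μ) :=
  posterior (sample μ n) π

/-- `f₀` is in the Kullback-Leibler support of `π`: every Kullback-Leibler neighbourhood
`{f | ∫ f₀ log (f₀ / f) dμ < ε}` has positive mass. -/
def InKLSupport (π : Measure (Density μ)) (f₀ : Density μ) : Prop :=
  ∀ ε : ℝ≥0∞, 0 < ε → 0 < π {f | InformationTheory.klDiv f₀.law f.law < ε}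

/-- The minimal number of `L¹` balls of radius `δ`, centred at densities, needed to cover `S`
(`⊤` when no finite number suffices). -/
def l1CoveringNumber (δ : ℝ) (S : Set (Density μ)) : ℕ∞ :=
  ⨅ (t : Finset (Density μ)) (_ : S ⊆ ⋃ c ∈ t, Metric.ball c δ), (t.card : ℕ∞)

/-- The `L¹` metric entropy `J(δ, S)`, an extended real number. -/
def l1Entropy (δ : ℝ) (S : Set (Density μ)) : EReal :=
  ENNReal.log (l1CoveringNumber δ S : ℝ≥0∞)

end Densities

section RoundingMap

/-- The latent space `ℝ^p = ℝ^{p₁} × ℝ^{p₂}`. -/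
abbrev Latent (p₁ p₂ : ℕ) : Type := (Fin p₁ → ℝ) × (Fin p₂ → ℝ)

/-- The space in which mixed-scale observations `(y₁, y₂)` live. The observations themselves lie in
the subset `𝒴 × Q` that carries the dominating measure `Rounding.dom`. -/
abbrev Obs (p₁ p₂ : ℕ) : Type := (Fin p₁ → ℝ) × (Fin p₂ → ℕ)

/-- The latent densities: the densities with respect to Lebesgue measure on `ℝ^p`. -/
abbrev LatentDensity (p₁ p₂ : ℕ) : Type := Density (volume : Measure (Latent p₁ p₂))

/-- The data of the rounding map `h = (h₁, h₂)`. The coordinates of `h₁` are monotone (in either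
direction), one-to-one and differentiable. The `j`-th discrete variable has `q j` levels (possibly
infinitely many); the level `k` corresponds to the block `A j k` of an ordered partition
`A j 0 < A j 1 < ⋯` of the real line; only the blocks `A j k` with `k < q j` are used. -/
structure Rounding (p₁ p₂ : ℕ) where
  h : Fin p₁ → ℝ → ℝ
  h_monotone : ∀ j, Monotone (h j) ∨ Antitone (h j)
  h_injective : ∀ j, Function.Injective (h j)
  h_differentiable : ∀ j, Differentiable ℝ (h j)
  h_deriv_ne_zero : ∀ j, ∀ᵐ x, deriv (h j) x ≠ 0
  q : Fin p₂ → ℕ∞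
  A : Fin p₂ → ℕ → Set ℝ
  A_nonempty : ∀ j (k : ℕ), (k : ℕ∞) < q j → (A j k).Nonempty
  A_cover : ∀ j (x : ℝ), ∃ k : ℕ, (k : ℕ∞) < q j ∧ x ∈ A j k
  A_ordered : ∀ j (k l : ℕ), k < l → (l : ℕ∞) < q j → ∀ x ∈ A j k, ∀ y ∈ A j l, x < y

namespace Rounding

variable {p₁ p₂ : ℕ} (R : Rounding p₁ p₂)

/-- The map `h₁` acting on the continuous coordinates. -/
def h₁ (x : Fin p₁ → ℝ) : Fin p₁ → ℝ := fun j => R.h j (x j)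

/-- The sample space `𝒴` of the continuous variables: the product of the ranges of the `h j`. -/
def 𝒴 : Set (Fin p₁ → ℝ) := {y | ∀ j, y j ∈ range (R.h j)}

/-- The sample space `Q` of the discrete variables. -/
def Q : Set (Fin p₂ → ℕ) := {y | ∀ j, (y j : ℕ∞) < R.q j}

/-- The inverse `h₁⁻¹` on `𝒴` (with junk values outside of `𝒴`). -/
def h₁Inv (y : Fin p₁ → ℝ) : Fin p₁ → ℝ := fun j => Function.invFun (R.h j) (y j)

/-- The box `A_{y₂}` of latent values that are rounded to `y₂`. -/
def box (y₂ : Fin p₂ → ℕ) : Set (Fin p₂ → ℝ) := {x | ∀ j, x j ∈ R.A j (y₂ j)}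

/-- The dominating measure: the product of Lebesgue measure on `𝒴` and counting measure on `Q`. -/
def dom : Measure (Obs p₁ p₂) := (volume.restrict R.𝒴).prod (Measure.count.restrict R.Q)

/-- The mixed-scale densities: the densities with respect to `R.dom`. -/
abbrev MixedDensity : Type := Density R.dom

/-- The defining formula of the mixed-scale density induced by a latent density:
`∫_{A_{y₂}} f (h₁⁻¹ y₁, x₂) |J_{h₁⁻¹}(y₁)| dx₂`. -/
def gFun (f : Latent p₁ p₂ → ℝ) (y : Obs p₁ p₂) : ℝ :=
  ∫ x₂ in R.box y.2, f (R.h₁Inv y.1, x₂) * |(fderiv ℝ R.h₁Inv y.1).det|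

/-! The formula defines a density. -/

theorem continuous_h (j : Fin p₁) : Continuous (R.h j) := (R.h_differentiable j).continuous

theorem injective_h₁ : Function.Injective R.h₁ := fun _ _ hxy =>
  funext fun j => R.h_injective j (congrFun hxy j)

theorem range_h₁ : range R.h₁ = R.𝒴 := by
  ext y
  constructor
  · rintro ⟨x, rfl⟩ j
    exact ⟨x j, rfl⟩
  · intro hy
    choose x hx using hy
    exact ⟨x, funext hx⟩

theorem h₁Inv_h₁ (x : Fin p₁ → ℝ) : R.h₁Inv (R.h₁ x) = x :=
  funext fun j => Function.leftInverse_invFun (R.h_injective j) (x j)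

theorem h₁_h₁Inv {y : Fin p₁ → ℝ} (hy : y ∈ R.𝒴) : R.h₁ (R.h₁Inv y) = y :=
  funext fun j => Function.invFun_eq (hy j)

theorem isOpenEmbedding_h (j : Fin p₁) : IsOpenEmbedding (R.h j) := by
  have hm : StrictMono (R.h j) ∨ StrictAnti (R.h j) :=
    (R.h_monotone j).imp (fun h => h.strictMono_of_injective (R.h_injective j))
      (fun h => h.strictAnti_of_injective (R.h_injective j))
  have hopen : ∀ f : ℝ → ℝ, Continuous f → StrictMono f → IsOpenMap f := by
    intro f hf hmono
    refine IsOpenMap.of_nhds_le fun x s hs => ?_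
    rw [mem_map] at hs
    obtain ⟨a, b, ⟨hax, hxb⟩, hab⟩ := mem_nhds_iff_exists_Ioo_subset.1 hs
    obtain ⟨a', haa', ha'x⟩ := exists_between hax
    obtain ⟨b', hxb', hb'b⟩ := exists_between hxb
    have hI : Icc (f a') (f b') ⊆ s := by
      refine (intermediate_value_Icc (ha'x.trans hxb').le hf.continuousOn).trans ?_
      rintro _ ⟨z, hz, rfl⟩
      exact hab ⟨haa'.trans_le hz.1, hz.2.trans_lt hb'b⟩
    exact mem_of_superset (Icc_mem_nhds (hmono ha'x) (hmono hxb')) hI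
  refine .of_continuous_injective_isOpenMap (R.continuous_h j) (R.h_injective j) ?_
  rcases hm with hm | hm
  · exact hopen _ (R.continuous_h j) hm
  · have h1 := hopen (fun x => - R.h j x) (R.continuous_h j).neg fun x y hxy => neg_lt_neg (hm hxy)
    have h2 := (Homeomorph.neg ℝ).isOpenMap.comp h1
    have h3 : (Homeomorph.neg ℝ) ∘ (fun x => - R.h j x) = R.h j := by
      funext x; simp
    rwa [h3] at h2

theorem isOpen_𝒴 : IsOpen R.𝒴 := by
  have : R.𝒴 = ⋂ j, (fun y : Fin p₁ → ℝ => y j) ⁻¹' range (R.h j) := by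
    ext y; simp [𝒴]
  rw [this]
  exact isOpen_iInter_of_finite fun j =>
    (R.isOpenEmbedding_h j).isOpen_range.preimage (continuous_apply j)

theorem measurable_h₁Inv : Measurable R.h₁Inv := by
  refine measurable_pi_lambda _ fun j => ?_
  have h1 : Measurable (Function.invFun (R.h j)) := by
    have := (R.isOpenEmbedding_h j).measurableEmbedding.measurable_extend
      (g := (id : ℝ → ℝ)) (g' := fun _ => Classical.arbitrary ℝ) measurable_id measurable_const
    convert this using 1
    funext y
    by_cases hy : ∃ x, R.h j x = y
    · obtain ⟨x, rfl⟩ := hy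
      rw [Function.leftInverse_invFun (R.h_injective j) x, (R.h_injective j).extend_apply]
      rfl
    · rw [Function.invFun_neg hy, Function.extend_apply' _ _ _ hy]
  exact h1.comp (measurable_pi_apply j)

theorem continuousAt_h₁Inv (x : Fin p₁ → ℝ) : ContinuousAt R.h₁Inv (R.h₁ x) := by
  refine continuousAt_pi.2 fun j => ?_
  have h1 : ContinuousAt (Function.invFun (R.h j)) (R.h j (x j)) := by
    rw [ContinuousAt, Function.leftInverse_invFun (R.h_injective j) (x j),
      ← (R.isOpenEmbedding_h j).map_nhds_eq, tendsto_map'_iff]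
    have : Function.invFun (R.h j) ∘ R.h j = id := Function.invFun_comp (R.h_injective j)
    rw [this]
    exact tendsto_id
  exact ContinuousAt.comp (f := fun y : Fin p₁ → ℝ => y j) (x := R.h₁ x) h1
    (continuous_apply j).continuousAt

theorem hasFDerivAt_h₁ (x : Fin p₁ → ℝ) : HasFDerivAt R.h₁
    (ContinuousLinearMap.pi fun j => (deriv (R.h j) (x j)) •
      (ContinuousLinearMap.proj j : (Fin p₁ → ℝ) →L[ℝ] ℝ)) x := by
  refine hasFDerivAt_pi.2 fun j => ?_
  exact ((R.h_differentiable j (x j)).hasDerivAt).comp_hasFDerivAt x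
    (ContinuousLinearMap.proj j : (Fin p₁ → ℝ) →L[ℝ] ℝ).hasFDerivAt

/-- The change of variables `y₁ = h₁ x₁`. -/
theorem lintegral_𝒴 (F : (Fin p₁ → ℝ) → ℝ≥0∞) :
    ∫⁻ y in R.𝒴, F (R.h₁Inv y) * ENNReal.ofReal |(fderiv ℝ R.h₁Inv y).det| = ∫⁻ x, F x := by
  set S : Set (Fin p₁ → ℝ) := {x | ∀ j, deriv (R.h j) (x j) ≠ 0} with hS
  have hSm : MeasurableSet S := by
    have : S = ⋂ j, (fun x : Fin p₁ → ℝ => deriv (R.h j) (x j)) ⁻¹' {0}ᶜ := by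
      ext x; simp [hS]
    rw [this]
    exact MeasurableSet.iInter fun j =>
      ((measurable_deriv (R.h j)).comp (measurable_pi_apply j)) (measurableSet_singleton 0).compl
  have hSae : ∀ᵐ x : Fin p₁ → ℝ, x ∈ S := by
    refine ae_all_iff.2 fun j => ?_
    exact (Measure.quasiMeasurePreserving_eval (fun _ : Fin p₁ => (volume : Measure ℝ)) j).ae
      (R.h_deriv_ne_zero j)
  have hSc : volume Sᶜ = 0 := hSae
  have himg : volume (R.h₁ '' Sᶜ) = 0 :=
    addHaar_image_eq_zero_of_differentiableOn_of_addHaar_eq_zero _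
      (fun x _ => (R.hasFDerivAt_h₁ x).differentiableAt.differentiableWithinAt) hSc
  have hres : volume.restrict R.𝒴 = volume.restrict (R.h₁ '' S) := by
    refine Measure.restrict_congr_set ?_
    rw [← R.range_h₁, ← image_univ, ← union_compl_self S, image_union]
    exact union_ae_eq_left_of_ae_eq_empty (ae_eq_empty.2 himg)
  rw [hres, lintegral_image_eq_lintegral_abs_det_fderiv_mul volume hSm
    (fun x _ => (R.hasFDerivAt_h₁ x).hasFDerivWithinAt) R.injective_h₁.injOn]
  have hFS : ∫⁻ x, F x = ∫⁻ x in S, F x := by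
    rw [Measure.restrict_eq_self_of_ae_mem hSae]
  rw [hFS]
  refine setLIntegral_congr_fun hSm fun x hx => ?_
  set D : (Fin p₁ → ℝ) →L[ℝ] (Fin p₁ → ℝ) := ContinuousLinearMap.pi fun j =>
    (deriv (R.h j) (x j)) • (ContinuousLinearMap.proj j : (Fin p₁ → ℝ) →L[ℝ] ℝ) with hD
  set E : (Fin p₁ → ℝ) →L[ℝ] (Fin p₁ → ℝ) := ContinuousLinearMap.pi fun j =>
    (deriv (R.h j) (x j))⁻¹ • (ContinuousLinearMap.proj j : (Fin p₁ → ℝ) →L[ℝ] ℝ) with hE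
  have hED : ∀ v, E (D v) = v := fun v => funext fun j => by
    simp [hE, hD, inv_mul_cancel_left₀ (hx j)]
  have hDE : ∀ v, D (E v) = v := fun v => funext fun j => by
    simp [hE, hD, mul_inv_cancel_left₀ (hx j)]
  have hfd : HasFDerivAt R.h₁Inv E (R.h₁ x) := by
    have h1 : HasFDerivAt R.h₁
        ((ContinuousLinearEquiv.equivOfInverse D E hED hDE : (Fin p₁ → ℝ) ≃L[ℝ] (Fin p₁ → ℝ)) :
          (Fin p₁ → ℝ) →L[ℝ] (Fin p₁ → ℝ)) (R.h₁Inv (R.h₁ x)) := by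
      rw [R.h₁Inv_h₁]
      exact R.hasFDerivAt_h₁ x
    have h2 := HasFDerivAt.of_local_left_inverse (R.continuousAt_h₁Inv x) h1
      (by
        have : R.𝒴 ∈ 𝓝 (R.h₁ x) := R.isOpen_𝒴.mem_nhds (R.range_h₁ ▸ mem_range_self x)
        filter_upwards [this] with y hy using R.h₁_h₁Inv hy)
    exact h2
  have hdet : D.det * E.det = 1 := by
    have h1 : (D.toLinearMap).comp E.toLinearMap = LinearMap.id := LinearMap.ext hDE
    have h2 := congrArg LinearMap.det h1
    rw [LinearMap.det_comp, LinearMap.det_id] at h2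
    exact h2
  rw [hfd.fderiv, R.h₁Inv_h₁, mul_comm (F x), ← mul_assoc, ← ENNReal.ofReal_mul (abs_nonneg _),
    ← abs_mul, hdet, abs_one, ENNReal.ofReal_one, one_mul]

theorem measurableSet_A (j : Fin p₂) (k : ℕ) (hk : (k : ℕ∞) < R.q j) :
    MeasurableSet (R.A j k) := by
  refine OrdConnected.measurableSet ⟨fun a ha b hb c hc => ?_⟩
  obtain ⟨l, hl, hcl⟩ := R.A_cover j c
  rcases lt_trichotomy l k with h | h | h
  · exact absurd hc.1 (not_le.2 (R.A_ordered j l k h hk c hcl a ha))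
  · exact h ▸ hcl
  · exact absurd hc.2 (not_le.2 (R.A_ordered j k l h hl b hb c hcl))

theorem measurableSet_box {y₂ : Fin p₂ → ℕ} (hy : y₂ ∈ R.Q) : MeasurableSet (R.box y₂) := by
  have : R.box y₂ = ⋂ j, (fun x : Fin p₂ → ℝ => x j) ⁻¹' R.A j (y₂ j) := by
    ext x; simp [box]
  rw [this]
  exact MeasurableSet.iInter fun j => measurable_pi_apply j (R.measurableSet_A j _ (hy j))

theorem box_disjoint {y z : Fin p₂ → ℕ} (hy : y ∈ R.Q) (hz : z ∈ R.Q) (hyz : y ≠ z) :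
    Disjoint (R.box y) (R.box z) := by
  obtain ⟨j, hj⟩ := Function.ne_iff.1 hyz
  refine Set.disjoint_left.2 fun x hx hx' => ?_
  rcases lt_or_gt_of_ne hj with h | h
  · exact lt_irrefl _ (R.A_ordered j _ _ h (hz j) _ (hx j) _ (hx' j))
  · exact lt_irrefl _ (R.A_ordered j _ _ h (hy j) _ (hx' j) _ (hx j))

/-- The density formula preserves integrals of non-negative functions. -/
theorem lintegral_dom (F : Latent p₁ p₂ → ℝ≥0∞) (hF : Measurable F) :
    ∫⁻ y, (∫⁻ x₂ in R.box y.2, F (R.h₁Inv y.1, x₂)) *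
      ENNReal.ofReal |(fderiv ℝ R.h₁Inv y.1).det| ∂(R.dom) = ∫⁻ x, F x := by
  have hm : Measurable fun y : Obs p₁ p₂ => (∫⁻ x₂ in R.box y.2, F (R.h₁Inv y.1, x₂)) *
      ENNReal.ofReal |(fderiv ℝ R.h₁Inv y.1).det| := by
    refine measurable_from_prod_countable_left fun y₂ => ?_
    refine Measurable.mul ?_ ?_
    · exact (hF.lintegral_prod_right' (ν := volume.restrict (R.box y₂))).comp R.measurable_h₁Inv
    · exact (ContinuousLinearMap.continuous_det.abs.measurable.comp
        (measurable_fderiv ℝ R.h₁Inv)).ennreal_ofReal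
  rw [dom, lintegral_prod_symm' _ hm]
  have h1 : ∀ y₂ : Fin p₂ → ℕ, ∫⁻ y₁ in R.𝒴, (∫⁻ x₂ in R.box y₂, F (R.h₁Inv y₁, x₂)) *
      ENNReal.ofReal |(fderiv ℝ R.h₁Inv y₁).det| = ∫⁻ x in univ ×ˢ R.box y₂, F x := by
    intro y₂
    rw [R.lintegral_𝒴 fun x₁ => ∫⁻ x₂ in R.box y₂, F (x₁, x₂)]
    have : (volume : Measure (Latent p₁ p₂)).restrict (univ ×ˢ R.box y₂) =
        (volume : Measure (Fin p₁ → ℝ)).prod (volume.restrict (R.box y₂)) := by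
      rw [Measure.volume_eq_prod, ← Measure.prod_restrict, Measure.restrict_univ]
    rw [this, lintegral_prod _ hF.aemeasurable]
  simp only [h1]
  rw [lintegral_countable _ R.Q.to_countable]
  simp only [Measure.count_singleton, mul_one]
  rw [← lintegral_iUnion (s := fun y : R.Q => (univ : Set (Fin p₁ → ℝ)) ×ˢ R.box y.1)
    (fun y => MeasurableSet.univ.prod (R.measurableSet_box y.2))
    (fun y z hyz => Disjoint.set_prod_right
      (R.box_disjoint y.2 z.2 (fun h => hyz (Subtype.ext h))) _ _)]
  have : (⋃ y : R.Q, (univ : Set (Fin p₁ → ℝ)) ×ˢ R.box y.1) = univ := by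
    refine eq_univ_of_forall fun x => ?_
    choose k hk hx using fun j => R.A_cover j (x.2 j)
    exact mem_iUnion.2 ⟨⟨k, hk⟩, trivial, hx⟩
  rw [this, Measure.restrict_univ]

theorem measurable_gFun (f : Latent p₁ p₂ → ℝ) (hf : StronglyMeasurable f) :
    Measurable (R.gFun f) := by
  refine measurable_from_prod_countable_left fun y₂ => ?_
  simp only [gFun, integral_mul_const]
  refine Measurable.mul ?_ ?_
  · exact ((hf.integral_prod_right' (ν := volume.restrict (R.box y₂))).measurable).comp
      R.measurable_h₁Inv
  · exact ContinuousLinearMap.continuous_det.abs.measurable.comp (measurable_fderiv ℝ R.h₁Inv)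

theorem gFun_ae_eq (f : LatentDensity p₁ p₂) : R.gFun f =ᵐ[R.dom]
    fun y => ((∫⁻ x₂ in R.box y.2, ENNReal.ofReal (f (R.h₁Inv y.1, x₂))) *
      ENNReal.ofReal |(fderiv ℝ R.h₁Inv y.1).det|).toReal := by
  have hfm : StronglyMeasurable f := f.stronglyMeasurable
  have hneg := R.lintegral_dom (fun x => ENNReal.ofReal (- f x)) hfm.measurable.neg.ennreal_ofReal
  have h0 : ∫⁻ x, ENNReal.ofReal (- f x) = 0 := by
    refine (lintegral_eq_zero_iff hfm.measurable.neg.ennreal_ofReal).2 ?_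
    filter_upwards [f.nonneg] with x hx
    simpa using hx
  have hm : Measurable fun y : Obs p₁ p₂ =>
      (∫⁻ x₂ in R.box y.2, ENNReal.ofReal (- f (R.h₁Inv y.1, x₂))) *
      ENNReal.ofReal |(fderiv ℝ R.h₁Inv y.1).det| := by
    refine measurable_from_prod_countable_left fun y₂ => ?_
    refine Measurable.mul ?_ ?_
    · exact (Measurable.lintegral_prod_right' (ν := volume.restrict (R.box y₂))
        (f := fun x : Latent p₁ p₂ => ENNReal.ofReal (- f x))
        hfm.measurable.neg.ennreal_ofReal).comp R.measurable_h₁Inv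
    · exact (ContinuousLinearMap.continuous_det.abs.measurable.comp
        (measurable_fderiv ℝ R.h₁Inv)).ennreal_ofReal
  rw [h0, lintegral_eq_zero_iff hm] at hneg
  filter_upwards [hneg] with y hy
  rw [gFun, integral_mul_const, ENNReal.toReal_mul, ENNReal.toReal_ofReal (abs_nonneg _)]
  rcases mul_eq_zero.1 hy with h | h
  · congr 1
    have hs : StronglyMeasurable fun x₂ => f (R.h₁Inv y.1, x₂) :=
      hfm.comp_measurable measurable_prodMk_left
    refine integral_eq_lintegral_of_nonneg_ae ?_ hs.aestronglyMeasurable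
    have h' := (lintegral_eq_zero_iff hs.measurable.neg.ennreal_ofReal).1 h
    filter_upwards [h'] with x₂ hx₂
    simpa using hx₂
  · have : |(fderiv ℝ R.h₁Inv y.1).det| = 0 :=
      le_antisymm (ENNReal.ofReal_eq_zero.1 h) (abs_nonneg _)
    simp [this]

theorem lintegral_gAux (f : LatentDensity p₁ p₂) :
    ∫⁻ y, (∫⁻ x₂ in R.box y.2, ENNReal.ofReal (f (R.h₁Inv y.1, x₂))) *
      ENNReal.ofReal |(fderiv ℝ R.h₁Inv y.1).det| ∂(R.dom) = 1 :=
  (R.lintegral_dom (fun x => ENNReal.ofReal (f x))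
    (f.stronglyMeasurable).measurable.ennreal_ofReal).trans f.lintegral_eq

theorem measurable_gAux (f : LatentDensity p₁ p₂) : Measurable fun y : Obs p₁ p₂ =>
    (∫⁻ x₂ in R.box y.2, ENNReal.ofReal (f (R.h₁Inv y.1, x₂))) *
      ENNReal.ofReal |(fderiv ℝ R.h₁Inv y.1).det| := by
  refine measurable_from_prod_countable_left fun y₂ => ?_
  refine Measurable.mul ?_ ?_
  · exact (Measurable.lintegral_prod_right' (ν := volume.restrict (R.box y₂))
      (f := fun x : Latent p₁ p₂ => ENNReal.ofReal (f x))
      (f.stronglyMeasurable).measurable.ennreal_ofReal).comp R.measurable_h₁Inv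
  · exact (ContinuousLinearMap.continuous_det.abs.measurable.comp
      (measurable_fderiv ℝ R.h₁Inv)).ennreal_ofReal

theorem integrable_gFun (f : LatentDensity p₁ p₂) : Integrable (R.gFun f) R.dom :=
  (integrable_toReal_of_lintegral_ne_top (R.measurable_gAux f).aemeasurable
    (by rw [R.lintegral_gAux f]; exact ENNReal.one_ne_top)).congr (R.gFun_ae_eq f).symm

theorem gFun_nonneg (f : LatentDensity p₁ p₂) : 0 ≤ᵐ[R.dom] R.gFun f := by
  filter_upwards [R.gFun_ae_eq f] with y hy
  rw [hy]
  exact ENNReal.toReal_nonneg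

theorem integral_gFun (f : LatentDensity p₁ p₂) : ∫ y, R.gFun f y ∂(R.dom) = 1 := by
  rw [integral_congr_ae (R.gFun_ae_eq f),
    integral_toReal (R.measurable_gAux f).aemeasurable
      (ae_lt_top (R.measurable_gAux f) (by rw [R.lintegral_gAux f]; exact ENNReal.one_ne_top)),
    R.lintegral_gAux f, ENNReal.toReal_one]

/-- The map `g` from latent densities to mixed-scale densities. -/
def g (f : LatentDensity p₁ p₂) : R.MixedDensity :=
  Density.mk (R.gFun f) (R.integrable_gFun f) (R.gFun_nonneg f) (R.integral_gFun f)

/-- The prior on mixed-scale densities induced by a prior on latent densities through `g`. -/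
def inducedPrior (π : Measure (LatentDensity p₁ p₂)) : Measure R.MixedDensity := π.map R.g

instance (π : Measure (LatentDensity p₁ p₂)) [IsFiniteMeasure π] :
    IsFiniteMeasure (R.inducedPrior π) :=
  inferInstanceAs (IsFiniteMeasure (π.map R.g))

instance : SFinite R.dom :=
  inferInstanceAs (SFinite ((volume.restrict R.𝒴).prod (Measure.count.restrict R.Q)))

instance : Nonempty (LatentDensity p₁ p₂) := by
  have hs : volume (Icc (0 : Fin p₁ → ℝ) 1 ×ˢ Icc (0 : Fin p₂ → ℝ) 1) = 1 := by
    rw [Measure.volume_eq_prod, Measure.prod_prod, Real.volume_Icc_pi, Real.volume_Icc_pi]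
    simp
  have hsm : MeasurableSet (Icc (0 : Fin p₁ → ℝ) 1 ×ˢ Icc (0 : Fin p₂ → ℝ) 1) :=
    measurableSet_Icc.prod measurableSet_Icc
  refine ⟨Density.mk
    ((Icc (0 : Fin p₁ → ℝ) 1 ×ˢ Icc (0 : Fin p₂ → ℝ) 1).indicator fun _ => (1 : ℝ)) ?_ ?_ ?_⟩
  · exact (integrable_indicator_iff hsm).2 (integrableOn_const (by rw [hs]; exact ENNReal.one_ne_top))
  · exact Eventually.of_forall fun x => indicator_nonneg (fun _ _ => zero_le_one) x
  · rw [integral_indicator_const _ hsm, measureReal_def, hs]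
    simp

instance : Nonempty R.MixedDensity := ⟨R.g (Classical.arbitrary _)⟩

end Rounding

end RoundingMap

end

end MixedScale

/-! The theorem is Schwartz's posterior consistency argument, applied on the mixed scale after a
transfer from the latent scale. The transfer rests on `dist_g_le`: the rounding map is an `L¹`
contraction, because the change of variables in `lintegral_dom` preserves integrals. Hence balls
covering a latent sieve are carried into balls of the same radius about the images of their centres,
and the union `W` of these has induced prior mass at least that of the sieve, while the number of
balls does not grow.

On the mixed scale, let `D n` be the integral over the prior of the likelihood ratio relative to
`f₀`. The posterior mass of `Uᶜ` is bounded by treating denominator and numerator apart. For the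
denominator, the strong law shows that on a Kullback-Leibler ball of radius `c` the ratio times `exp
(n * c)` tends to infinity; Fubini and Fatou carry this over to `D n`
(`ae_tendsto_exp_mul_lintegral_likelihoodRatio`). For the numerator, each ball far from `f₀` is
tested by the empirical frequency of the set where its centre exceeds `f₀`; Hoeffding's inequality
bounds both errors, and the entropy bound keeps the union over the balls exponentially small
(`exists_test`). Markov's inequality and Borel-Cantelli turn the tests into an almost sure bound on
`D n` times the posterior mass of `Uᶜ`, which is then divided by the lower bound for `D n`
(`ae_tendsto_posteriorDist_of_tests`). -/

namespace MixedScale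

/-! ### Product measures and Hoeffding bounds -/

section ProductMeasures

variable {α : Type*} [MeasurableSpace α]

theorem lintegral_pi_prod {n : ℕ} (P : Measure α) [IsProbabilityMeasure P]
    (f : Fin n → α → ℝ≥0∞) (hf : ∀ i, Measurable (f i)) :
    ∫⁻ y, ∏ i, f i (y i) ∂(Measure.pi fun _ : Fin n => P) = ∏ i, ∫⁻ x, f i x ∂P := by
  have hind : iIndepFun (fun (i : Fin n) (y : Fin n → α) => f i (y i))
      (Measure.pi fun _ : Fin n => P) :=
    iIndepFun_pi (X := f) fun i => (hf i).aemeasurable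
  rw [lintegral_prod_eq_prod_lintegral_of_indepFun Finset.univ
    (fun i (y : Fin n → α) => f i (y i)) hind
    (fun i => (hf i).comp (measurable_pi_apply i))]
  refine Finset.prod_congr rfl fun i _ => ?_
  exact (measurePreserving_eval (fun _ : Fin n => P) i).lintegral_comp (hf i)

/-- The product outer measure is the largest one bounded on boxes by the product of the side masses,
so only boxes need checking, and there the integral factorises. An inequality is all that is
available when `K` has a part singular to `P`. -/
theorem pi_withDensity_prod_le {n : ℕ} (P K : Measure α) [IsProbabilityMeasure P]
    [IsProbabilityMeasure K] {r : α → ℝ≥0∞} (hr : Measurable r) (h : P.withDensity r ≤ K) :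
    (Measure.pi fun _ : Fin n => P).withDensity (fun y => ∏ i, r (y i)) ≤
      Measure.pi fun _ : Fin n => K := by
  have hle : ((Measure.pi fun _ : Fin n => P).withDensity
      (fun y => ∏ i, r (y i))).toOuterMeasure ≤
        OuterMeasure.pi fun _ : Fin n => K.toOuterMeasure := by
    refine OuterMeasure.le_pi.2 fun s _ => ?_
    -- The sides of the boxes may be non-measurable; measurable hulls for `K` leave the right-hand
    -- side unchanged.
    set t : Fin n → Set α := fun i => toMeasurable K (s i) with ht
    have htm : ∀ i, MeasurableSet (t i) := fun i => measurableSet_toMeasurable K (s i)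
    have hst : univ.pi s ⊆ univ.pi t := pi_mono fun i _ => subset_toMeasurable K (s i)
    refine (measure_mono hst).trans ?_
    rw [Measure.coe_toOuterMeasure, withDensity_apply _ (MeasurableSet.univ_pi htm),
      ← lintegral_indicator (MeasurableSet.univ_pi htm)]
    have hprod : (fun y : Fin n → α => (univ.pi t).indicator (fun y => ∏ i, r (y i)) y) =
        fun y => ∏ i, (t i).indicator r (y i) := by
      funext y
      by_cases hy : y ∈ univ.pi t
      · rw [indicator_of_mem hy]
        exact Finset.prod_congr rfl fun i _ => (indicator_of_mem (hy i trivial) _).symm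
      · rw [indicator_of_notMem hy]
        simp only [Set.mem_pi, mem_univ, true_implies, not_forall] at hy
        obtain ⟨i, hi⟩ := hy
        exact (Finset.prod_eq_zero (Finset.mem_univ i) (indicator_of_notMem hi _)).symm
    rw [hprod, lintegral_pi_prod P _ fun i => hr.indicator (htm i)]
    refine Finset.prod_le_prod' fun i _ => ?_
    rw [lintegral_indicator (htm i), ← withDensity_apply _ (htm i)]
    refine (h (t i)).trans ?_
    rw [ht, measure_toMeasurable]
    rfl
  refine Measure.le_intro fun s hs _ => ?_
  refine (hle s).trans_eq ?_
  rw [Measure.pi, toMeasure_apply _ _ hs]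

theorem infinitePi_map_fin (P : Measure α) [IsProbabilityMeasure P] (n : ℕ) :
    (Measure.infinitePi fun _ : ℕ => P).map (fun y (i : Fin n) => y i) =
      Measure.pi fun _ : Fin n => P := by
  have h := Measure.map_infinitePi_infinitePi_of_inj (P := fun _ : ℕ => P)
    (f := fun i : Fin n => (i : ℕ)) Fin.val_injective
  rw [h, Measure.infinitePi_eq_pi]

/-- Hoeffding's inequality for the empirical frequency of a set. -/
theorem measureReal_pi_empirical_ge_le {n : ℕ} (P : Measure α) [IsProbabilityMeasure P]
    {A : Set α} (hA : MeasurableSet A) {t : ℝ} (ht : 0 ≤ t) :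
    (Measure.pi fun _ : Fin n => P).real
      {y | n * (P.real A + t) ≤ ∑ i, A.indicator (fun _ => (1 : ℝ)) (y i)} ≤
        Real.exp (-(2 * n * t ^ 2)) := by
  rcases Nat.eq_zero_or_pos n with rfl | hn
  · simp
  set X : α → ℝ := A.indicator (fun _ => (1 : ℝ)) with hX
  have hXm : Measurable X := measurable_const.indicator hA
  have hmean : ∫ x, X x ∂P = P.real A := by
    rw [hX, integral_indicator_const _ hA, smul_eq_mul, mul_one]
  have hsub : HasSubgaussianMGF (fun x => X x - P.real A) ((‖(1 : ℝ) - 0‖₊ / 2) ^ 2) P := by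
    rw [← hmean]
    refine hasSubgaussianMGF_of_mem_Icc hXm.aemeasurable (Eventually.of_forall fun x => ?_)
    by_cases hx : x ∈ A <;> simp [hX, hx]
  have hind : iIndepFun (fun (i : Fin n) (y : Fin n → α) => X (y i) - P.real A)
      (Measure.pi fun _ : Fin n => P) :=
    iIndepFun_pi (X := fun _ x => X x - P.real A) fun i => (hXm.sub_const _).aemeasurable
  have hsubi : ∀ i ∈ Finset.univ, HasSubgaussianMGF (fun y : Fin n → α => X (y i) - P.real A)
      ((‖(1 : ℝ) - 0‖₊ / 2) ^ 2) (Measure.pi fun _ : Fin n => P) := by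
    intro i _
    have hmap := (measurePreserving_eval (fun _ : Fin n => P) i)
    refine HasSubgaussianMGF.of_map (Y := fun y : Fin n → α => y i)
      (X := fun x => X x - P.real A) hmap.measurable.aemeasurable ?_
    rw [hmap.map_eq]
    exact hsub
  have hmain := HasSubgaussianMGF.measure_sum_ge_le_of_iIndepFun hind hsubi
    (ε := n * t) (by positivity)
  have hset : {y : Fin n → α | n * (P.real A + t) ≤ ∑ i, X (y i)} =
      {y | n * t ≤ ∑ i, (X (y i) - P.real A)} := by
    ext y
    simp only [mem_ofPred_eq, Finset.sum_sub_distrib, Finset.sum_const, Finset.card_univ,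
      Fintype.card_fin, nsmul_eq_mul]
    constructor <;> intro h <;> linarith
  rw [hset]
  refine hmain.trans (Real.exp_le_exp.2 (le_of_eq ?_))
  have hn' : (n : ℝ) ≠ 0 := by positivity
  simp
  field_simp

/-- The upper tail bound applied to the complement of `A`. -/
theorem measureReal_pi_empirical_le_le {n : ℕ} (P : Measure α) [IsProbabilityMeasure P]
    {A : Set α} (hA : MeasurableSet A) {t : ℝ} (ht : 0 ≤ t) :
    (Measure.pi fun _ : Fin n => P).real
      {y | ∑ i, A.indicator (fun _ => (1 : ℝ)) (y i) ≤ n * (P.real A - t)} ≤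
        Real.exp (-(2 * n * t ^ 2)) := by
  have h := measureReal_pi_empirical_ge_le (n := n) P hA.compl ht
  convert h using 3
  ext y
  have hsum : ∑ i, Aᶜ.indicator (fun _ => (1 : ℝ)) (y i) =
      n - ∑ i, A.indicator (fun _ => (1 : ℝ)) (y i) := by
    rw [eq_sub_iff_add_eq, ← Finset.sum_add_distrib]
    simp only [indicator_compl_add_self_apply]
    simp
  rw [hsum, measureReal_compl hA, probReal_univ]
  constructor <;> intro h <;> linarith

end ProductMeasures

/-! ### Lower bound for the integrated likelihood ratio -/

section LikelihoodRatio

variable {α Θ : Type*} [MeasurableSpace α] [MeasurableSpace Θ]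

/-- By the strong law, minus the logarithm of the product grows like `n` times the divergence, which
is below `c`. Any `c'` strictly between the two gives the lower bound `exp (n * (c - c'))`. -/
theorem ae_tendsto_exp_mul_prod_of_klDiv_lt (P K : Measure α) [IsProbabilityMeasure P]
    [IsProbabilityMeasure K] {c : ℝ}
    (hKL : InformationTheory.klDiv P K < ENNReal.ofReal c) {r : α → ℝ≥0∞}
    (hr : r =ᵐ[P] K.rnDeriv P) :
    ∀ᵐ y ∂(Measure.infinitePi fun _ : ℕ => P), Tendsto
      (fun n : ℕ => ENNReal.ofReal (Real.exp (n * c)) * ∏ i : Fin n, r (y i)) atTop (𝓝 ∞) := by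
  obtain ⟨hac, hint⟩ := InformationTheory.klDiv_ne_top_iff.1 hKL.ne_top
  have hmean : ∫ x, llr P K x ∂P < c := by
    rw [← InformationTheory.toReal_klDiv_of_measure_eq hac (by simp)]
    exact (ENNReal.lt_ofReal_iff_toReal_lt hKL.ne_top).1 hKL
  set L : α → ℝ := llr P K with hL
  have hLm : Measurable L := measurable_llr P K
  have hrL : ∀ᵐ x ∂P, r x = ENNReal.ofReal (Real.exp (-L x)) := by
    filter_upwards [hr, exp_neg_llr hac, K.rnDeriv_lt_top P] with x h1 h2 h3
    rw [h1, h2, ENNReal.ofReal_toReal (by simpa using h3.ne)]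
  have hrL' : ∀ᵐ y ∂(Measure.infinitePi fun _ : ℕ => P),
      ∀ i, r (y i) = ENNReal.ofReal (Real.exp (-L (y i))) :=
    ae_all_iff.2 fun i =>
      (measurePreserving_eval_infinitePi (fun _ : ℕ => P) i).quasiMeasurePreserving.ae hrL
  have hslln := strong_law_ae_real (μ := Measure.infinitePi fun _ : ℕ => P)
    (fun i y => L (y i))
    ((measurePreserving_eval_infinitePi (fun _ : ℕ => P) 0).integrable_comp_of_integrable hint)
    (fun i j hij => (iIndepFun_infinitePi (P := fun _ : ℕ => P) (X := fun _ => L)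
      fun _ => hLm).indepFun hij)
    (fun i => by
      refine IdentDistrib.comp (u := L) (f := fun y : ℕ → α => y i) (g := fun y : ℕ → α => y 0) ?_ hLm
      exact ⟨(measurable_pi_apply i).aemeasurable, (measurable_pi_apply 0).aemeasurable, by
        rw [Measure.infinitePi_map_eval, Measure.infinitePi_map_eval]⟩)
  have hmean0 : ∫ y, L (y 0) ∂(Measure.infinitePi fun _ : ℕ => P) = ∫ x, L x ∂P := by
    have := (measurePreserving_eval_infinitePi (fun _ : ℕ => P) 0)
    conv_rhs => rw [← this.map_eq]
    rw [integral_map this.measurable.aemeasurable hLm.aestronglyMeasurable]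
  filter_upwards [hrL', hslln] with y hy hlim
  rw [hmean0] at hlim
  obtain ⟨c', hc1, hc2⟩ := exists_between hmean
  have hlow : ∀ᶠ n : ℕ in atTop, ENNReal.ofReal (Real.exp (n * (c - c'))) ≤
      ENNReal.ofReal (Real.exp (n * c)) * ∏ i : Fin n, r (y i) := by
    filter_upwards [hlim.eventually_lt_const hc1, eventually_gt_atTop 0] with n hn hn0
    have hn0' : (0 : ℝ) < n := by exact_mod_cast hn0
    rw [div_lt_iff₀ hn0'] at hn
    simp only [hy]
    rw [← ENNReal.ofReal_prod_of_nonneg fun i _ => (Real.exp_pos _).le, ← Real.exp_sum,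
      ← ENNReal.ofReal_mul (Real.exp_pos _).le, ← Real.exp_add]
    refine ENNReal.ofReal_le_ofReal (Real.exp_le_exp.2 ?_)
    rw [Finset.sum_neg_distrib, Fin.sum_univ_eq_sum_range (fun i => L (y i))]
    linarith
  refine tendsto_nhds_top_mono ?_ hlow
  refine ENNReal.tendsto_ofReal_nhds_top.2 ?_
  exact Real.tendsto_exp_atTop.comp
    (tendsto_natCast_atTop_atTop.atTop_mul_const (sub_pos.2 hc2))

variable [MeasurableSpace.CountablyGenerated α]

/-- The likelihood of `n` observations under `κ θ` relative to `P` (the density of the absolutely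
continuous part of the `n`-fold product). -/
noncomputable def likelihoodRatio (κ : Kernel Θ α) (P : Measure α) (n : ℕ) (θ : Θ)
    (y : Fin n → α) : ℝ≥0∞ :=
  ∏ i, κ.rnDeriv (Kernel.const Θ P) θ (y i)

/-- Joint measurability, needed for Fubini, is the reason for using the kernel version of the
Radon-Nikodym derivative. -/
theorem measurable_likelihoodRatio (κ : Kernel Θ α) (P : Measure α) (n : ℕ) :
    Measurable fun p : Θ × (Fin n → α) => likelihoodRatio κ P n p.1 p.2 := by
  refine Finset.measurable_prod _ fun i _ => ?_
  exact (Kernel.measurable_rnDeriv κ (Kernel.const Θ P)).comp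
    (measurable_fst.prodMk ((measurable_pi_apply i).comp measurable_snd))

theorem withDensity_likelihoodRatio_le (κ : Kernel Θ α) [IsMarkovKernel κ] (P : Measure α)
    [IsProbabilityMeasure P] (n : ℕ) (θ : Θ) :
    (Measure.pi fun _ : Fin n => P).withDensity (likelihoodRatio κ P n θ) ≤
      Measure.pi fun _ : Fin n => κ θ := by
  refine pi_withDensity_prod_le P (κ θ) (Kernel.measurable_rnDeriv_right κ _ θ) ?_
  refine (withDensity_congr_ae (Kernel.rnDeriv_eq_rnDeriv_measure (κ := κ)
    (η := Kernel.const Θ P) (a := θ))).le.trans ?_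
  exact Measure.withDensity_rnDeriv_le _ _

/-- If every Kullback-Leibler neighbourhood of `P` has positive prior mass, then the integrated
likelihood ratio is almost surely not exponentially small. -/
theorem ae_tendsto_exp_mul_lintegral_likelihoodRatio (κ : Kernel Θ α) [IsMarkovKernel κ]
    (P : Measure α) [IsProbabilityMeasure P] (π : Measure Θ) [IsFiniteMeasure π] {c : ℝ}
    (hKL : 0 < π {θ | InformationTheory.klDiv P (κ θ) < ENNReal.ofReal c}) :
    ∀ᵐ y ∂(Measure.infinitePi fun _ : ℕ => P), Tendsto
      (fun n : ℕ => ENNReal.ofReal (Real.exp (n * c)) *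
        ∫⁻ θ, likelihoodRatio κ P n θ (fun i => y i) ∂π) atTop (𝓝 ∞) := by
  set F : ℕ → Θ × (ℕ → α) → ℝ≥0∞ := fun n p =>
    ENNReal.ofReal (Real.exp (n * c)) * likelihoodRatio κ P n p.1 (fun i => p.2 i) with hF
  have hFm : ∀ n, Measurable (F n) := fun n => by
    refine Measurable.const_mul ?_ _
    exact (measurable_likelihoodRatio κ P n).comp (measurable_fst.prodMk
      (measurable_pi_lambda _ fun i => (measurable_pi_apply _).comp measurable_snd))
  set G : Set (Θ × (ℕ → α)) := {p | liminf (fun n => F n p) atTop = ∞} with hG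
  have hGm : MeasurableSet G := (Measurable.liminf hFm) (measurableSet_singleton _)
  -- `B` contains the Kullback-Leibler ball and is measurable, so measurability of the ball itself
  -- is not needed.
  set B : Set Θ := {θ | (Measure.infinitePi fun _ : ℕ => P) (Prod.mk θ ⁻¹' Gᶜ) = 0} with hB
  have hBm : MeasurableSet B :=
    measurable_measure_prodMk_left hGm.compl (measurableSet_singleton _)
  have hBpos : 0 < π B := by
    refine hKL.trans_le (measure_mono fun θ hθ => ?_)
    have h := ae_tendsto_exp_mul_prod_of_klDiv_lt P (κ θ) hθ
      (Kernel.rnDeriv_eq_rnDeriv_measure (κ := κ) (η := Kernel.const Θ P) (a := θ))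
    have h' : ∀ᵐ y ∂(Measure.infinitePi fun _ : ℕ => P), (θ, y) ∈ G := by
      filter_upwards [h] with y hy using hy.liminf_eq
    exact h'
  have hprod : ((π.restrict B).prod (Measure.infinitePi fun _ : ℕ => P)) Gᶜ = 0 := by
    rw [Measure.prod_apply hGm.compl, lintegral_eq_zero_iff
      (measurable_measure_prodMk_left hGm.compl)]
    exact ae_restrict_of_forall_mem hBm fun θ hθ => hθ
  have hswap : ∀ᵐ y ∂(Measure.infinitePi fun _ : ℕ => P), ∀ᵐ θ ∂(π.restrict B), (θ, y) ∈ G := by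
    have h0 : ∀ᵐ p ∂((π.restrict B).prod (Measure.infinitePi fun _ : ℕ => P)), p ∈ G := hprod
    rw [← Measure.prod_swap] at h0
    exact Measure.ae_ae_of_ae_prod (ae_of_ae_map measurable_swap.aemeasurable h0)
  filter_upwards [hswap] with y hy
  -- The integrand has infinite lower limit almost everywhere on `B`, a set of positive mass, so by
  -- Fatou the integrals tend to infinity.
  have hfatou := lintegral_liminf_le (μ := π.restrict B) (u := atTop) (f := fun n θ => F n (θ, y))
    fun n => (hFm n).comp measurable_prodMk_right
  rw [lintegral_congr_ae (g := fun _ => ∞) hy, lintegral_const, Measure.restrict_apply_univ,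
    ENNReal.top_mul hBpos.ne', top_le_iff] at hfatou
  have hlim : Tendsto (fun n => ∫⁻ θ in B, F n (θ, y) ∂π) atTop (𝓝 ∞) :=
    by
    refine tendsto_of_le_liminf_of_limsup_le (f := atTop) ?_ le_top
    exact hfatou.ge
  refine tendsto_nhds_top_mono hlim (Eventually.of_forall fun n => ?_)
  refine (setLIntegral_le_lintegral _ _).trans_eq ?_
  simp only [hF]
  exact lintegral_const_mul' _ _ ENNReal.ofReal_ne_top

end LikelihoodRatio

end MixedScale

namespace MixedScale

/-! ### Bayes' formula in integrated form, and Borel-Cantelli -/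

section Posterior

variable {α Θ : Type*} [MeasurableSpace α] [MeasurableSpace Θ]

/-- Both sides are the joint probability of data in `E` and parameter in `B`. This takes the place
of a density formula for the posterior. -/
theorem setLIntegral_posterior {β : Type*} [MeasurableSpace β] [StandardBorelSpace Θ] [Nonempty Θ]
    (κ : Kernel Θ β) [IsFiniteKernel κ] (π : Measure Θ) [IsFiniteMeasure π] {E : Set β}
    (hE : MeasurableSet E) {B : Set Θ} (hB : MeasurableSet B) :
    ∫⁻ y in E, posterior κ π y B ∂(κ ∘ₘ π) = ∫⁻ θ in B, κ θ E ∂π := by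
  have h : ((κ ∘ₘ π) ⊗ₘ posterior κ π) (E ×ˢ B) = ((π ⊗ₘ κ).map Prod.swap) (E ×ˢ B) := by
    rw [compProd_posterior_eq_map_swap]
  rw [Measure.compProd_apply_prod hE hB, Measure.map_apply measurable_swap (hE.prod hB),
    preimage_swap_prod, Measure.compProd_apply_prod hB hE] at h
  exact h

variable [MeasurableSpace.CountablyGenerated α]

theorem withDensity_lintegral_likelihoodRatio_le (κ : Kernel Θ α) [IsMarkovKernel κ]
    (P : Measure α) [IsProbabilityMeasure P] (π : Measure Θ) [IsFiniteMeasure π] {n : ℕ}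
    (κn : Kernel Θ (Fin n → α)) [IsMarkovKernel κn]
    (hκn : ∀ θ, κn θ = Measure.pi fun _ => κ θ) :
    (Measure.pi fun _ : Fin n => P).withDensity
      (fun y => ∫⁻ θ, likelihoodRatio κ P n θ y ∂π) ≤ κn ∘ₘ π := by
  refine Measure.le_intro fun s hs _ => ?_
  rw [withDensity_apply _ hs, Measure.bind_apply hs κn.aemeasurable,
    lintegral_lintegral_swap (f := fun y θ => likelihoodRatio κ P n θ y) ((measurable_likelihoodRatio κ P n).comp
      measurable_swap).aemeasurable]
  refine lintegral_mono fun θ => ?_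
  rw [← withDensity_apply _ hs, hκn]
  exact withDensity_likelihoodRatio_le κ P n θ s

/-- The marginal law of the data dominates the measure with density the integrated likelihood ratio
relative to `P`. With this weight, integrals under `P` are controlled by the marginal, the law up to
whose null sets the posterior is determined. -/
theorem setLIntegral_posterior_mul_le [StandardBorelSpace Θ] [Nonempty Θ]
    (κ : Kernel Θ α) [IsMarkovKernel κ] (P : Measure α) [IsProbabilityMeasure P] (π : Measure Θ)
    [IsFiniteMeasure π] {n : ℕ} (κn : Kernel Θ (Fin n → α)) [IsMarkovKernel κn]
    (hκn : ∀ θ, κn θ = Measure.pi fun _ => κ θ) {E : Set (Fin n → α)} (hE : MeasurableSet E)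
    {B : Set Θ} (hB : MeasurableSet B) :
    ∫⁻ y in E, (∫⁻ θ, likelihoodRatio κ P n θ y ∂π) * posterior κn π y B
      ∂(Measure.pi fun _ : Fin n => P) ≤ ∫⁻ θ in B, κn θ E ∂π := by
  have hD : Measurable fun y : Fin n → α => ∫⁻ θ, likelihoodRatio κ P n θ y ∂π :=
    (measurable_likelihoodRatio κ P n).lintegral_prod_left'
  rw [← setLIntegral_posterior κn π hE hB]
  have h := setLIntegral_withDensity_eq_setLIntegral_mul (Measure.pi fun _ : Fin n => P) hD
    ((posterior κn π).measurable_coe hB) hE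
  refine h.symm.le.trans ?_
  exact lintegral_mono' (Measure.restrict_mono subset_rfl
    (withDensity_lintegral_likelihoodRatio_le κ P π κn hκn)) le_rfl

/-- Borel-Cantelli, after replacing by `∅` the sets whose bound fails. -/
theorem ae_eventually_notMem_of_eventually_le {Ω : Type*} [MeasurableSpace Ω] {ν : Measure Ω}
    {s : ℕ → Set Ω} {b : ℕ → ℝ} (hb : Summable b)
    (h : ∀ᶠ n in atTop, ν (s n) ≤ ENNReal.ofReal (b n)) :
    ∀ᵐ ω ∂ν, ∀ᶠ n in atTop, ω ∉ s n := by
  classical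
  have hle : ∀ n, ν (if ν (s n) ≤ ENNReal.ofReal (b n) then s n else ∅) ≤
      ENNReal.ofReal (b n) := by
    intro n
    split_ifs with hn
    · exact hn
    · simp
  filter_upwards [ae_eventually_notMem
    (ne_top_of_le_ne_top hb.tsum_ofReal_ne_top (ENNReal.tsum_le_tsum hle))] with ω hω
  filter_upwards [hω, h] with n h1 h2
  rwa [if_pos h2] at h1

end Posterior

/-! ### Exponentially powerful tests -/

section Tests

variable {α : Type*} [MeasurableSpace α] {μ : Measure α}

theorem Density.law_real (f : Density μ) {A : Set α} (hA : MeasurableSet A) :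
    f.law.real A = ∫ x in A, f x ∂μ := by
  rw [measureReal_def, Density.law, withDensity_apply _ hA,
    ← ofReal_integral_eq_lintegral_ofReal f.integrable.integrableOn (ae_restrict_of_ae f.nonneg),
    ENNReal.toReal_ofReal (integral_nonneg_of_ae (ae_restrict_of_ae f.nonneg))]

/-- The set on which `c` exceeds `f₀` separates the laws of densities close to `c` from that
of `f₀`. -/
theorem Density.law_real_sub_ge (f c f₀ : Density μ) :
    dist c f₀ / 2 - dist f c ≤ f.law.real {x | f₀ x < c x} - f₀.law.real {x | f₀ x < c x} := by
  set A : Set α := {x | f₀ x < c x} with hA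
  have hAm : MeasurableSet A :=
    measurableSet_lt f₀.stronglyMeasurable.measurable c.stronglyMeasurable.measurable
  have hci : Integrable (fun x => c x - f₀ x) μ := c.integrable.sub f₀.integrable
  have hfi : Integrable (fun x => f x - c x) μ := f.integrable.sub c.integrable
  -- Both densities have integral one, so the positive and negative parts of `c - f₀` have equal
  -- mass.
  have h1 : dist c f₀ = 2 * ∫ x in A, (c x - f₀ x) ∂μ := by
    have hpt : ∀ x, |c x - f₀ x| = 2 * A.indicator (fun x => c x - f₀ x) x - (c x - f₀ x) := by
      intro x
      by_cases hx : x ∈ A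
      · rw [indicator_of_mem hx, abs_of_pos (sub_pos.2 hx)]
        ring
      · rw [indicator_of_notMem hx, abs_of_nonpos (sub_nonpos.2 (not_lt.1 hx))]
        ring
    rw [Density.dist_eq]
    simp only [hpt]
    rw [integral_sub ((hci.indicator hAm).const_mul 2) hci, integral_const_mul,
      integral_indicator hAm, integral_sub c.integrable f₀.integrable, c.integral_eq,
      f₀.integral_eq]
    simp
  have h2 : -dist f c ≤ ∫ x in A, (f x - c x) ∂μ := by
    rw [Density.dist_eq, neg_le]
    calc -∫ x in A, (f x - c x) ∂μ ≤ |∫ x in A, (f x - c x) ∂μ| := neg_le_abs _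
      _ ≤ ∫ x in A, |f x - c x| ∂μ := abs_integral_le_integral_abs
      _ ≤ ∫ x, |f x - c x| ∂μ :=
        setIntegral_le_integral hfi.abs (Eventually.of_forall fun x => abs_nonneg _)
  rw [integral_sub c.integrable.integrableOn f₀.integrable.integrableOn] at h1
  rw [integral_sub f.integrable.integrableOn c.integrable.integrableOn] at h2
  rw [f.law_real hAm, f₀.law_real hAm]
  linarith

/-- A test of `f₀` against the densities at distance at least `8 * t` from `f₀` in a finite union
of balls of radius `δ ≤ t`. -/
theorem exists_test (n : ℕ) (f₀ : Density μ) (T : Finset (Density μ)) {δ t : ℝ} (ht : 0 ≤ t)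
    (hδ : δ ≤ t) :
    ∃ E : Set (Fin n → α), MeasurableSet E ∧
      (Measure.pi fun _ : Fin n => f₀.law) Eᶜ ≤
        ENNReal.ofReal (T.card * Real.exp (-(2 * n * t ^ 2))) ∧
      ∀ f ∈ ⋃ c ∈ T, Metric.ball c δ, 8 * t ≤ dist f f₀ →
        (Measure.pi fun _ : Fin n => f.law) E ≤ ENNReal.ofReal (Real.exp (-(2 * n * t ^ 2))) := by
  set A : Density μ → Set α := fun c => {x | f₀ x < c x} with hA
  have hAm : ∀ c, MeasurableSet (A c) := fun c =>
    measurableSet_lt f₀.stronglyMeasurable.measurable c.stronglyMeasurable.measurable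
  set S : Density μ → (Fin n → α) → ℝ := fun c y =>
    ∑ i, (A c).indicator (fun _ => (1 : ℝ)) (y i) with hS
  have hSm : ∀ c, Measurable (S c) := fun c =>
    Finset.measurable_sum _ fun i _ =>
      (measurable_const.indicator (hAm c)).comp (measurable_pi_apply i)
  set G : Density μ → Set (Fin n → α) := fun c => {y | n * (f₀.law.real (A c) + t) ≤ S c y}
    with hG
  have hGm : ∀ c, MeasurableSet (G c) := fun c => measurableSet_le measurable_const (hSm c)
  -- `E` is the region where `f₀` is accepted: no centre's set is hit too often.
  refine ⟨(⋃ c ∈ T, G c)ᶜ, (Finset.measurableSet_biUnion T fun c _ => hGm c).compl, ?_, ?_⟩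
  · rw [compl_compl]
    refine (measure_biUnion_finset_le T G).trans ?_
    have hle : ∀ c ∈ T, (Measure.pi fun _ : Fin n => f₀.law) (G c) ≤
        ENNReal.ofReal (Real.exp (-(2 * n * t ^ 2))) := fun c _ =>
      ENNReal.le_ofReal_iff_toReal_le (measure_ne_top _ _) (Real.exp_pos _).le |>.2
        (measureReal_pi_empirical_ge_le f₀.law (hAm c) ht)
    refine (Finset.sum_le_card_nsmul T _ _ hle).trans_eq ?_
    rw [nsmul_eq_mul, ENNReal.ofReal_mul (Nat.cast_nonneg _), ENNReal.ofReal_natCast]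
  · intro f hf hdist
    simp only [mem_iUnion, Metric.mem_ball] at hf
    obtain ⟨c, hcT, hfc⟩ := hf
    have hsep := Density.law_real_sub_ge f c f₀
    have htri : dist f f₀ ≤ dist f c + dist c f₀ := dist_triangle _ _ _
    -- The separation is at least `(8 * t - t) / 2 - t`, which exceeds the required `2 * t`: one `t`
    -- for each error.
    have hge : f₀.law.real (A c) + t ≤ f.law.real (A c) - t := by
      change dist c f₀ / 2 - dist f c ≤ f.law.real (A c) - f₀.law.real (A c) at hsep
      linarith
    refine (measure_mono (t := {y | S c y ≤ n * (f.law.real (A c) - t)}) ?_).trans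
      (ENNReal.le_ofReal_iff_toReal_le (measure_ne_top _ _) (Real.exp_pos _).le |>.2
        (measureReal_pi_empirical_le_le f.law (hAm c) ht))
    intro y hy
    have hy' : y ∉ G c := fun h => hy (mem_biUnion (Finset.mem_coe.2 hcT) h)
    have hlt : S c y < n * (f₀.law.real (A c) + t) := not_le.1 hy'
    exact hlt.le.trans (mul_le_mul_of_nonneg_left hge (Nat.cast_nonneg n))

end Tests

/-! ### Posterior consistency for a general dominating measure -/

section Consistency

variable {α : Type*} [MeasurableSpace α] {μ : Measure α}

/-- The law `P_f` as a Markov kernel in `f`. -/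
noncomputable def lawKernel (μ : Measure α) : Kernel (Density μ) α where
  toFun := Density.law
  measurable' := Density.measurable_law

instance : IsMarkovKernel (lawKernel μ) :=
  ⟨fun f => inferInstanceAs (IsProbabilityMeasure f.law)⟩

variable [MeasurableSpace.CountablyGenerated α] [SFinite μ] [Nonempty (Density μ)]

/-- If with overwhelming probability the posterior mass of the complement of `U`, weighted by the
likelihood ratio, is exponentially small, then the posterior concentrates on `U`. -/
theorem ae_tendsto_posteriorDist_of_tests (π : Measure (Density μ)) [IsProbabilityMeasure π]
    (f₀ : Density μ) (hKL : InKLSupport π f₀) {U : Set (Density μ)} (hU : MeasurableSet U)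
    {s γ C : ℝ} (hs : 0 < s) (hγ : 0 < γ) (hC : 0 ≤ C)
    (htest : ∀ᶠ n : ℕ in atTop, ∃ E : Set (Fin n → α), MeasurableSet E ∧
      (Measure.pi fun _ : Fin n => f₀.law) Eᶜ ≤ ENNReal.ofReal (Real.exp (n * -s)) ∧
      ∫⁻ f in Uᶜ, sample μ n f E ∂π ≤ ENNReal.ofReal (C * Real.exp (-(n * γ)))) :
    ∀ᵐ y ∂(Measure.infinitePi fun _ : ℕ => f₀.law),
      Tendsto (fun n : ℕ => posteriorDist π n (fun i : Fin n => y i) U) atTop (𝓝 1) := by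
  set D : (n : ℕ) → (Fin n → α) → ℝ≥0∞ := fun n y =>
    ∫⁻ f, likelihoodRatio (lawKernel μ) f₀.law n f y ∂π with hD
  have hDm : ∀ n, Measurable (D n) := fun n =>
    (measurable_likelihoodRatio (lawKernel μ) f₀.law n).lintegral_prod_left'
  have hpm : ∀ n, Measurable fun y => posteriorDist π n y Uᶜ := fun n =>
    (posteriorDist π n).measurable_coe hU.compl
  -- The rate `γ` is split: Markov's inequality spends half, the lower bound on `D n` a quarter, and
  -- the last quarter remains as the rate of the posterior.
  set V : (n : ℕ) → Set (Fin n → α) := fun n =>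
    {y | ENNReal.ofReal (Real.exp (-(n * (γ / 2)))) ≤ D n y * posteriorDist π n y Uᶜ} with hV
  have hVm : ∀ n, MeasurableSet (V n) := fun n =>
    measurableSet_le measurable_const ((hDm n).mul (hpm n))
  have hres : ∀ n : ℕ, Measurable fun (y : ℕ → α) (i : Fin n) => y i := fun n =>
    measurable_pi_lambda _ fun i => measurable_pi_apply _
  have hbad : ∀ᶠ n : ℕ in atTop, (Measure.infinitePi fun _ : ℕ => f₀.law)
      {y | (fun i : Fin n => y i) ∈ V n} ≤
        ENNReal.ofReal (Real.exp (n * -s) + C * Real.exp (n * -(γ / 2))) := by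
    filter_upwards [htest] with n hn
    obtain ⟨E, hEm, hE1, hE2⟩ := hn
    have hmarg := setLIntegral_posterior_mul_le (lawKernel μ) f₀.law π (sample μ n)
      (fun f => rfl) hEm hU.compl
    have hmark : (Measure.pi fun _ : Fin n => f₀.law) (V n ∩ E) ≤
        ENNReal.ofReal (C * Real.exp (n * -(γ / 2))) := by
      have h1 := mul_meas_ge_le_lintegral (μ := (Measure.pi fun _ : Fin n => f₀.law).restrict E)
        ((hDm n).mul (hpm n)) (ENNReal.ofReal (Real.exp (-(n * (γ / 2)))))
      have h2 := (h1.trans hmarg).trans hE2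
      have hV' : ((Measure.pi fun _ : Fin n => f₀.law).restrict E) (V n) =
          (Measure.pi fun _ : Fin n => f₀.law) (V n ∩ E) := Measure.restrict_apply (hVm n)
      have h3 : ENNReal.ofReal (Real.exp (-(n * (γ / 2)))) *
          (Measure.pi fun _ : Fin n => f₀.law) (V n ∩ E) ≤
            ENNReal.ofReal (C * Real.exp (-(n * γ))) := by
        rw [← hV']; exact h2
      have h4 : ENNReal.ofReal (Real.exp (n * (γ / 2))) *
          ENNReal.ofReal (Real.exp (-(n * (γ / 2)))) = 1 := by
        rw [← ENNReal.ofReal_mul (Real.exp_pos _).le, ← Real.exp_add]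
        simp
      calc (Measure.pi fun _ : Fin n => f₀.law) (V n ∩ E)
          = ENNReal.ofReal (Real.exp (n * (γ / 2))) *
            (ENNReal.ofReal (Real.exp (-(n * (γ / 2)))) *
              (Measure.pi fun _ : Fin n => f₀.law) (V n ∩ E)) := by
            rw [← mul_assoc, h4, one_mul]
        _ ≤ ENNReal.ofReal (Real.exp (n * (γ / 2))) *
            ENNReal.ofReal (C * Real.exp (-(n * γ))) := by gcongr
        _ = ENNReal.ofReal (C * Real.exp (n * -(γ / 2))) := by
            rw [← ENNReal.ofReal_mul (Real.exp_pos _).le, mul_left_comm, ← Real.exp_add]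
            ring_nf
    have hmap : (Measure.infinitePi fun _ : ℕ => f₀.law) {y | (fun i : Fin n => y i) ∈ V n} =
        (Measure.pi fun _ : Fin n => f₀.law) (V n) := by
      rw [← infinitePi_map_fin, Measure.map_apply (hres n) (hVm n)]
      rfl
    rw [hmap]
    calc (Measure.pi fun _ : Fin n => f₀.law) (V n)
        ≤ (Measure.pi fun _ : Fin n => f₀.law) (Eᶜ ∪ V n ∩ E) := by
          refine measure_mono fun y hy => ?_
          by_cases hyE : y ∈ E
          · exact Or.inr ⟨hy, hyE⟩
          · exact Or.inl hyE
      _ ≤ _ := measure_union_le _ _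
      _ ≤ _ := add_le_add hE1 hmark
      _ = _ := (ENNReal.ofReal_add (Real.exp_pos _).le (mul_nonneg hC (Real.exp_pos _).le)).symm
  have hsum : Summable fun n : ℕ => Real.exp (n * -s) + C * Real.exp (n * -(γ / 2)) :=
    (Real.summable_exp_nat_mul_iff.2 (neg_lt_zero.2 hs)).add
      ((Real.summable_exp_nat_mul_iff.2 (neg_lt_zero.2 (half_pos hγ))).mul_left C)
  have hden := ae_tendsto_exp_mul_lintegral_likelihoodRatio (lawKernel μ) f₀.law π
    (c := γ / 4) (hKL _ (ENNReal.ofReal_pos.2 (by positivity)))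
  filter_upwards [ae_eventually_notMem_of_eventually_le hsum hbad, hden] with y hy hyD
  have hcompl : Tendsto (fun n : ℕ => posteriorDist π n (fun i : Fin n => y i) Uᶜ)
      atTop (𝓝 0) := by
    have hup : Tendsto (fun n : ℕ => ENNReal.ofReal (Real.exp (-(n * (γ / 4))))) atTop (𝓝 0) := by
      rw [← ENNReal.ofReal_zero]
      refine ENNReal.tendsto_ofReal (Real.tendsto_exp_neg_atTop_nhds_zero.comp ?_)
      exact tendsto_natCast_atTop_atTop.atTop_mul_const (by positivity)
    refine tendsto_of_tendsto_of_tendsto_of_le_of_le' tendsto_const_nhds hup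
      (Eventually.of_forall fun _ => zero_le) ?_
    filter_upwards [hy, hyD.eventually_const_lt ENNReal.one_lt_top] with n h1 h2
    have h1' : D n (fun i => y i) * posteriorDist π n (fun i => y i) Uᶜ <
        ENNReal.ofReal (Real.exp (-(n * (γ / 2)))) := not_le.1 h1
    calc posteriorDist π n (fun i => y i) Uᶜ
        = 1 * posteriorDist π n (fun i => y i) Uᶜ := (one_mul _).symm
      _ ≤ (ENNReal.ofReal (Real.exp (n * (γ / 4))) * D n (fun i => y i)) *
          posteriorDist π n (fun i => y i) Uᶜ := by gcongr
      _ ≤ ENNReal.ofReal (Real.exp (n * (γ / 4))) *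
          ENNReal.ofReal (Real.exp (-(n * (γ / 2)))) := by
        rw [mul_assoc]
        gcongr
      _ = ENNReal.ofReal (Real.exp (-(n * (γ / 4)))) := by
        rw [← ENNReal.ofReal_mul (Real.exp_pos _).le, ← Real.exp_add]
        ring_nf
  have hone : ∀ n (z : Fin n → α), posteriorDist π n z U = 1 - posteriorDist π n z Uᶜ := by
    intro n z
    have : IsProbabilityMeasure (posteriorDist π n z) :=
      inferInstanceAs (IsProbabilityMeasure (posterior (sample μ n) π z))
    have h := prob_compl_eq_one_sub (μ := posteriorDist π n z) hU.compl
    rwa [compl_compl] at h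
  simp only [hone]
  simpa using ENNReal.Tendsto.sub tendsto_const_nhds hcompl (Or.inl ENNReal.one_ne_top)

/-- Posterior consistency in `L¹` under Kullback-Leibler support of the prior and an entropy
condition, with finite covers of the sieves. -/
theorem ae_tendsto_posteriorDist (π : Measure (Density μ)) [IsProbabilityMeasure π]
    (f₀ : Density μ) (hKL : InKLSupport π f₀)
    (hsieve : ∀ ε : ℝ, 0 < ε → ∃ δ c₁ c₂ β : ℝ, δ < ε ∧ 0 < c₂ ∧ β < ε ^ 2 / 8 ∧
      ∃ T : ℕ → Finset (Density μ), ∀ᶠ n : ℕ in atTop,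
        π (⋃ c ∈ T n, Metric.ball c δ)ᶜ ≤ ENNReal.ofReal (c₁ * Real.exp (-(n * c₂))) ∧
        ((T n).card : ℝ) ≤ Real.exp (n * β))
    {ε : ℝ} (hε : 0 < ε) :
    ∀ᵐ y ∂(Measure.infinitePi fun _ : ℕ => f₀.law),
      Tendsto (fun n : ℕ => posteriorDist π n (fun i : Fin n => y i) {f | dist f f₀ < ε})
        atTop (𝓝 1) := by
  -- With `t = ε / 8`, distance `ε` is the `8 * t` of the test, and `β < t ^ 2 / 8` is below the
  -- Hoeffding rate `2 * t ^ 2`.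
  obtain ⟨δ, c₁, c₂, β, hδ, hc₂, hβ, T, hT⟩ := hsieve (ε / 8) (by positivity)
  set t := ε / 8 with ht
  have ht0 : 0 < t := by positivity
  have hU : MeasurableSet {f : Density μ | dist f f₀ < ε} :=
    (Metric.isOpen_ball (x := f₀) (ε := ε)).measurableSet
  refine ae_tendsto_posteriorDist_of_tests π f₀ hKL hU (s := 2 * t ^ 2 - β)
    (γ := min (2 * t ^ 2) c₂) (C := 1 + max c₁ 0) (by nlinarith) (lt_min (by positivity) hc₂)
    (by positivity) ?_
  filter_upwards [hT] with n hn
  obtain ⟨hmass, hcard⟩ := hn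
  obtain ⟨E, hEm, hE1, hE2⟩ := exists_test n f₀ (T n) ht0.le hδ.le
  set W : Set (Density μ) := ⋃ c ∈ T n, Metric.ball c δ with hW
  have hWm : MeasurableSet W :=
    Finset.measurableSet_biUnion _ fun c _ => Metric.isOpen_ball.measurableSet
  refine ⟨E, hEm, hE1.trans (ENNReal.ofReal_le_ofReal ?_), ?_⟩
  · calc ((T n).card : ℝ) * Real.exp (-(2 * n * t ^ 2))
        ≤ Real.exp (n * β) * Real.exp (-(2 * n * t ^ 2)) := by gcongr
      _ = Real.exp (n * -(2 * t ^ 2 - β)) := by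
        rw [← Real.exp_add]
        ring_nf
  -- Densities outside the cover are not tested; the trivial bound 1 is paid for by the small prior
  -- mass of `Wᶜ`.
  have hle : ∀ f ∈ {f : Density μ | dist f f₀ < ε}ᶜ, sample μ n f E ≤
      ENNReal.ofReal (Real.exp (-(2 * n * t ^ 2))) + Wᶜ.indicator (fun _ => 1) f := by
    intro f hf
    by_cases hfW : f ∈ W
    · refine le_add_right (hE2 f hfW ?_)
      have : ε ≤ dist f f₀ := not_lt.1 hf
      rw [ht]
      linarith
    · rw [indicator_of_mem (show f ∈ Wᶜ from hfW)]
      exact le_add_left prob_le_one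
  calc ∫⁻ f in {f : Density μ | dist f f₀ < ε}ᶜ, sample μ n f E ∂π
      ≤ ∫⁻ f in {f : Density μ | dist f f₀ < ε}ᶜ,
        (ENNReal.ofReal (Real.exp (-(2 * n * t ^ 2))) + Wᶜ.indicator (fun _ => 1) f) ∂π :=
        setLIntegral_mono' hU.compl hle
    _ ≤ ∫⁻ f, (ENNReal.ofReal (Real.exp (-(2 * n * t ^ 2))) + Wᶜ.indicator (fun _ => 1) f) ∂π :=
        setLIntegral_le_lintegral _ _
    _ = ENNReal.ofReal (Real.exp (-(2 * n * t ^ 2))) + π Wᶜ := by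
        rw [lintegral_add_left measurable_const, lintegral_const, measure_univ, mul_one,
          lintegral_indicator hWm.compl, setLIntegral_one]
    _ ≤ ENNReal.ofReal (Real.exp (-(2 * n * t ^ 2))) +
        ENNReal.ofReal (c₁ * Real.exp (-(n * c₂))) := by gcongr
    _ ≤ ENNReal.ofReal (Real.exp (-(n * min (2 * t ^ 2) c₂))) +
        ENNReal.ofReal (max c₁ 0 * Real.exp (-(n * min (2 * t ^ 2) c₂))) := by
        have h1 : (n : ℝ) * min (2 * t ^ 2) c₂ ≤ n * (2 * t ^ 2) :=
          mul_le_mul_of_nonneg_left (min_le_left _ _) (Nat.cast_nonneg n)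
        have h2 : (n : ℝ) * min (2 * t ^ 2) c₂ ≤ n * c₂ :=
          mul_le_mul_of_nonneg_left (min_le_right _ _) (Nat.cast_nonneg n)
        refine add_le_add (ENNReal.ofReal_le_ofReal (Real.exp_le_exp.2 (by linarith)))
          (ENNReal.ofReal_le_ofReal ?_)
        exact mul_le_mul (le_max_left _ _) (Real.exp_le_exp.2 (by linarith)) (Real.exp_pos _).le
          (le_max_right _ _)
    _ = ENNReal.ofReal ((1 + max c₁ 0) * Real.exp (-(n * min (2 * t ^ 2) c₂))) := by
        rw [add_mul, one_mul, ENNReal.ofReal_add (Real.exp_pos _).le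
          (mul_nonneg (le_max_right _ _) (Real.exp_pos _).le)]

end Consistency

end MixedScale

/-! ### Transfer of covers and prior mass through the rounding map -/

namespace MixedScale

theorem exists_finset_cover_of_l1Entropy_lt {α : Type*} [MeasurableSpace α] {μ : Measure α}
    {δ a : ℝ} {S : Set (Density μ)} (h : l1Entropy δ S < (a : EReal)) :
    ∃ T : Finset (Density μ), S ⊆ ⋃ c ∈ T, Metric.ball c δ ∧ (T.card : ℝ) ≤ Real.exp a := by
  have h1 : ((l1CoveringNumber δ S : ℝ≥0∞)) < ENNReal.ofReal (Real.exp a) := by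
    rw [l1Entropy] at h
    have h2 := EReal.exp_strictMono h
    rwa [ENNReal.exp_log, EReal.exp_coe] at h2
  have hne : (l1CoveringNumber δ S) ≠ ⊤ := by
    intro h0
    rw [h0] at h1
    simp at h1
  -- An infimum in `ℕ∞` is attained. A minimiser that failed to cover would have value `⊤`, against
  -- the finite entropy bound.
  obtain ⟨T, hT⟩ := ENat.exists_eq_iInf (fun t : Finset (Density μ) =>
    ⨅ _ : S ⊆ ⋃ c ∈ t, Metric.ball c δ, (t.card : ℕ∞))
  change _ = l1CoveringNumber δ S at hT
  by_cases hST : S ⊆ ⋃ c ∈ T, Metric.ball c δ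
  · rw [iInf_pos hST] at hT
    refine ⟨T, hST, ?_⟩
    rw [← hT] at h1
    have h2 : ENNReal.ofReal (T.card : ℝ) < ENNReal.ofReal (Real.exp a) := by simpa using h1
    exact (ENNReal.ofReal_lt_ofReal_iff (Real.exp_pos _)).1 h2 |>.le
  · rw [iInf_neg hST] at hT
    exact absurd hT.symm hne

namespace Rounding

variable {p₁ p₂ : ℕ} (R : Rounding p₁ p₂)

theorem measurable_lintegral_box_mul {F : Latent p₁ p₂ → ℝ≥0∞} (hF : Measurable F) :
    Measurable fun y : Obs p₁ p₂ => (∫⁻ x₂ in R.box y.2, F (R.h₁Inv y.1, x₂)) *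
      ENNReal.ofReal |(fderiv ℝ R.h₁Inv y.1).det| := by
  refine measurable_from_prod_countable_left fun y₂ => ?_
  refine Measurable.mul ?_ ?_
  · exact (hF.lintegral_prod_right' (ν := volume.restrict (R.box y₂))).comp R.measurable_h₁Inv
  · exact (ContinuousLinearMap.continuous_det.abs.measurable.comp
      (measurable_fderiv ℝ R.h₁Inv)).ennreal_ofReal

/-- For almost every observation the integral defining `g f` converges, unless the Jacobian
factor vanishes. -/
theorem ae_det_eq_zero_or_integrableOn (f : LatentDensity p₁ p₂) :
    ∀ᵐ y ∂(R.dom), |(fderiv ℝ R.h₁Inv y.1).det| = 0 ∨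
      IntegrableOn (fun x₂ => f (R.h₁Inv y.1, x₂)) (R.box y.2) := by
  have hm := R.measurable_lintegral_box_mul f.stronglyMeasurable.measurable.enorm
  have hfin : ∫⁻ y, (∫⁻ x₂ in R.box y.2, ‖f (R.h₁Inv y.1, x₂)‖ₑ) *
      ENNReal.ofReal |(fderiv ℝ R.h₁Inv y.1).det| ∂(R.dom) ≠ ∞ := by
    rw [R.lintegral_dom (fun x => ‖f x‖ₑ) f.stronglyMeasurable.measurable.enorm]
    exact f.integrable.hasFiniteIntegral.ne
  filter_upwards [ae_lt_top hm hfin] with y hy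
  rcases eq_or_ne |(fderiv ℝ R.h₁Inv y.1).det| 0 with h0 | h0
  · exact Or.inl h0
  · refine Or.inr ⟨(f.stronglyMeasurable.comp_measurable
      measurable_prodMk_left).aestronglyMeasurable, ?_⟩
    by_contra hinf
    rw [HasFiniteIntegral, not_lt, top_le_iff] at hinf
    rw [hinf, ENNReal.top_mul] at hy
    · exact lt_irrefl _ hy
    · exact (ENNReal.ofReal_pos.2 ((abs_nonneg _).lt_of_ne' h0)).ne'

/-- The map `g` is a contraction. -/
theorem dist_g_le (f f' : LatentDensity p₁ p₂) : dist (R.g f) (R.g f') ≤ dist f f' := by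
  have hae : ∀ᵐ y ∂(R.dom), ‖R.g f y - R.g f' y‖ₑ ≤
      (∫⁻ x₂ in R.box y.2, ‖f (R.h₁Inv y.1, x₂) - f' (R.h₁Inv y.1, x₂)‖ₑ) *
        ENNReal.ofReal |(fderiv ℝ R.h₁Inv y.1).det| := by
    filter_upwards [Density.coe_mk (R.gFun f) (R.integrable_gFun f) (R.gFun_nonneg f)
      (R.integral_gFun f), Density.coe_mk (R.gFun f') (R.integrable_gFun f') (R.gFun_nonneg f')
      (R.integral_gFun f'), R.ae_det_eq_zero_or_integrableOn f,
      R.ae_det_eq_zero_or_integrableOn f'] with y h1 h2 h3 h4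
    rw [g, g, h1, h2, gFun, gFun, integral_mul_const, integral_mul_const, ← sub_mul]
    -- The Bochner integral is additive only on integrable functions; where integrability may fail,
    -- the Jacobian factor is zero and kills both terms.
    by_cases h0 : |(fderiv ℝ R.h₁Inv y.1).det| = 0
    · simp [h0]
    · rw [← integral_sub (h3.resolve_left h0) (h4.resolve_left h0), enorm_mul,
        Real.enorm_of_nonneg (abs_nonneg _)]
      gcongr
      exact enorm_integral_le_lintegral_enorm _
  have hm : Measurable fun x : Latent p₁ p₂ => ‖f x - f' x‖ₑ :=
    (f.stronglyMeasurable.measurable.sub f'.stronglyMeasurable.measurable).enorm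
  have hle := lintegral_mono_ae hae
  rw [R.lintegral_dom (fun x => ‖f x - f' x‖ₑ) hm] at hle
  rw [Density.dist_eq, Density.dist_eq]
  have h1 := integral_norm_eq_lintegral_enorm
    ((R.g f).integrable.sub (R.g f').integrable).aestronglyMeasurable
  have h2 := integral_norm_eq_lintegral_enorm
    (f.integrable.sub f'.integrable).aestronglyMeasurable
  simp only [Real.norm_eq_abs, Pi.sub_apply] at h1 h2
  rw [h1, h2]
  exact ENNReal.toReal_mono (f.integrable.sub f'.integrable).hasFiniteIntegral.ne hle

/-- Continuity makes `g` Borel measurable, so that the pushforward defining the induced prior is a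
genuine probability measure. -/
theorem continuous_g : Continuous R.g :=
  (LipschitzWith.of_dist_le_mul (K := 1) fun f f' => by simpa using R.dist_g_le f f').continuous

instance (π : Measure (LatentDensity p₁ p₂)) [IsProbabilityMeasure π] :
    IsProbabilityMeasure (R.inducedPrior π) :=
  Measure.isProbabilityMeasure_map R.continuous_g.measurable.aemeasurable

/-- Only `W` has to be measurable: the sieve `S` may be arbitrary, its complement being measured by
outer measure. -/
theorem inducedPrior_compl_le (π : Measure (LatentDensity p₁ p₂)) {S : Set (LatentDensity p₁ p₂)}
    {W : Set R.MixedDensity} (hW : MeasurableSet W) (h : S ⊆ R.g ⁻¹' W) :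
    R.inducedPrior π Wᶜ ≤ π Sᶜ := by
  rw [inducedPrior, Measure.map_apply R.continuous_g.measurable hW.compl, preimage_compl]
  exact measure_mono (compl_subset_compl.2 h)

/-- A finite cover of a set of latent densities induces one of the mixed-scale densities, with no
more balls. -/
theorem exists_finset_cover {δ : ℝ} {S : Set (LatentDensity p₁ p₂)}
    {T : Finset (LatentDensity p₁ p₂)} (h : S ⊆ ⋃ c ∈ T, Metric.ball c δ) :
    ∃ T' : Finset R.MixedDensity, T'.card ≤ T.card ∧
      S ⊆ R.g ⁻¹' ⋃ c ∈ T', Metric.ball c δ := by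
  classical
  refine ⟨T.image R.g, Finset.card_image_le, fun f hf => ?_⟩
  obtain ⟨c, hc, hfc⟩ := mem_iUnion₂.1 (h hf)
  exact mem_iUnion₂.2 ⟨R.g c, Finset.mem_image_of_mem _ hc, (R.dist_g_le f c).trans_lt hfc⟩

end Rounding

end MixedScale

theorem theorem1 {p₁ p₂ : ℕ} (R : MixedScale.Rounding p₁ p₂)
    (Pstar : Measure (MixedScale.LatentDensity p₁ p₂)) [IsProbabilityMeasure Pstar]
    (f₀ : R.MixedDensity)
    (hKL : MixedScale.InKLSupport (R.inducedPrior Pstar) f₀)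
    (hsieve : ∀ ε : ℝ, 0 < ε → ∃ δ c₁ c₂ β : ℝ, 0 < δ ∧ δ < ε ∧ 0 < c₁ ∧ 0 < c₂ ∧
      β < ε ^ 2 / 8 ∧ ∃ S : ℕ → Set (MixedScale.LatentDensity p₁ p₂), ∀ᶠ n : ℕ in atTop,
        Pstar (S n)ᶜ ≤ ENNReal.ofReal (c₁ * Real.exp (-(n * c₂))) ∧
        MixedScale.l1Entropy δ (S n) < ((n * β : ℝ) : EReal)) :
    ∀ ε : ℝ, 0 < ε → ∀ᵐ y ∂(Measure.infinitePi fun _ : ℕ => f₀.law),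
      Tendsto
        (fun n : ℕ => MixedScale.posteriorDist (R.inducedPrior Pstar) n (fun i : Fin n => y i)
          {f | dist f f₀ < ε})
        atTop (𝓝 1) := by
  intro ε hε
  refine MixedScale.ae_tendsto_posteriorDist (R.inducedPrior Pstar) f₀ hKL (fun η hη => ?_) hε
  obtain ⟨δ, c₁, c₂, β, -, hδ, -, hc₂, hβ, S, hS⟩ := hsieve η hη
  -- The entropy bound holds only for large `n`; for the others the empty family serves as a
  -- default.
  have hcover : ∀ n : ℕ, ∃ T : Finset R.MixedDensity,
      MixedScale.l1Entropy δ (S n) < ((n * β : ℝ) : EReal) →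
        (S n ⊆ R.g ⁻¹' ⋃ c ∈ T, Metric.ball c δ) ∧ (T.card : ℝ) ≤ Real.exp (n * β) := by
    intro n
    by_cases h : MixedScale.l1Entropy δ (S n) < ((n * β : ℝ) : EReal)
    · obtain ⟨T, hT, hcard⟩ := MixedScale.exists_finset_cover_of_l1Entropy_lt h
      obtain ⟨T', hT'card, hT'⟩ := R.exists_finset_cover hT
      exact ⟨T', fun _ => ⟨hT', (Nat.cast_le.2 hT'card).trans hcard⟩⟩
    · exact ⟨∅, fun h' => absurd h' h⟩
  choose T hT using hcover
  refine ⟨δ, c₁, c₂, β, hδ, hc₂, hβ, T, ?_⟩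
  filter_upwards [hS] with n hn
  obtain ⟨hsub, hcard⟩ := hT n hn.2
  exact ⟨(R.inducedPrior_compl_le Pstar (Finset.measurableSet_biUnion _ fun c _ =>
    Metric.isOpen_ball.measurableSet) hsub).trans hn.1, hcard⟩
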